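/- **Theorem.** A $3$-graph is a $3$-uniform hypergraph. The degree of a vertex is the number of edges containing it, and $\delta_1(G)$ denotes the minimum vertex degree of $G$. For a $3$-graph $F$, a $3$-graph $G$ has an $F$-covering if every vertex of $G$ is contained in a copy of $F$ in $G$ (a not necessarily induced subgraph isomorphic to $F$). Let $$c_1(n,F)=\max\{\delta_1(G): G \text{ is a } 3\text{-graph on } n \text{ vertices with no } F\text{-covering}\},\qquad c_1(F)=\lim_{n\to\infty} \frac{c_1(n,F)}{\binom{n-1}{2}}.$$ Let $C_5^{(3)}$ be the tight $5$-cycle: the $3$-graph with vertex set $\mathbb{Z}/5\mathbb{Z}$ and edges $\{i,i+1,i+2\}$ for $i\in\mathbb{Z}/5\mathbb{Z}$. Then the limit $c_1(C_5^{(3)})$ exists, and $$\frac{5}{9}\le c_1(C_5^{(3)})\le 2-\sqrt{2}.$$ -/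

import Mathlib

open Filter Topology

noncomputable section

namespace Hypergraph

/-- `G` is `r`-uniform (an `r`-graph): each edge consists of exactly `r` vertices. -/
def IsUniform {α : Type*} (G : Hypergraph α) (r : ℕ) : Prop :=
  ∀ e ∈ G.edgeSet, e.encard = r

/-- The neighbourhood of `S`: the sets `T`, disjoint from `S`, such that `S ∪ T` is an edge. -/
def neighborhood {α : Type*} (G : Hypergraph α) (S : Set α) : Set (Set α) :=
  {T | Disjoint S T ∧ S ∪ T ∈ G.edgeSet}

/-- The degree of `S`: the size of its neighbourhood. -/
def degree {α : Type*} (G : Hypergraph α) (S : Set α) : ℕ :=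
  (G.neighborhood S).ncard

/-- The minimum `i`-degree: the minimum of the degrees of all `i`-subsets of the vertex set. -/
def minDegree {α : Type*} (i : ℕ) (G : Hypergraph α) : ℕ :=
  sInf {d | ∃ S ⊆ G.vertexSet, S.encard = i ∧ G.degree S = d}

/-- The map `f`, restricted to the vertices of `F`, embeds `F` into `G` as a (not necessarily
induced) subgraph. Its image is a copy of `F` in `G`, with vertex set `f '' F.vertexSet`. -/
def IsCopy {α β : Type*} (F : Hypergraph β) (G : Hypergraph α) (f : β → α) : Prop :=
  Set.InjOn f F.vertexSet ∧ Set.MapsTo f F.vertexSet G.vertexSet ∧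
    ∀ e ∈ F.edgeSet, f '' e ∈ G.edgeSet

/-- `G` has an `F`-covering: every vertex of `G` is contained in a copy of `F` in `G`. -/
def HasCovering {α β : Type*} (F : Hypergraph β) (G : Hypergraph α) : Prop :=
  ∀ v ∈ G.vertexSet, ∃ f : β → α, IsCopy F G f ∧ v ∈ f '' F.vertexSet

/-- The `i`-degree `F`-covering threshold `c_i(n, F)` of an `r`-graph `F`: the maximum of the
minimum `i`-degree over all `n`-vertex `r`-graphs without an `F`-covering. -/
def coveringThreshold {β : Type*} (r i n : ℕ) (F : Hypergraph β) : ℕ :=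
  sSup {d | ∃ G : Hypergraph (Fin n),
    G.vertexSet = Set.univ ∧ G.IsUniform r ∧ ¬ HasCovering F G ∧ G.minDegree i = d}

/-- The ratio `c_i(n, F) / binom(n - i, r - i)`, for an `r`-graph `F`. -/
def coveringRatio {β : Type*} (r i : ℕ) (F : Hypergraph β) (n : ℕ) : ℝ :=
  (coveringThreshold r i n F : ℝ) / ((n - i).choose (r - i) : ℝ)

/-- The `i`-degree `F`-covering density `c_i(F)` of an `r`-graph `F`: the limit of
`c_i(n, F) / binom(n - i, r - i)` as `n` tends to infinity. -/
def coveringDensity {β : Type*} (r i : ℕ) (F : Hypergraph β) : ℝ :=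
  limUnder atTop (coveringRatio r i F)

/-- The tight `r`-uniform `t`-cycle `C_t^{(r)}` (for `t ≥ r`): its vertices are the integers
modulo `t`, and its edges are the sets of `r` cyclically consecutive vertices. -/
def tightCycle (r t : ℕ) : Hypergraph (ZMod t) where
  vertexSet := Set.univ
  edgeSet := {e | ∃ i : ZMod t, e = (fun j : ℕ => i + (j : ZMod t)) '' Set.Iio r}
  subset_vertexSet_of_mem_edgeSet' := fun _ _ => Set.subset_univ _

end Hypergraph

end

/-! ### Degrees counted by ordered pairs -/

namespace Hypergraph

/-! Upper bound. Let `v` lie in no tight 5-cycle, let `δ` be the minimum degree, and by averaging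
choose `p` such that the set `A` of all `q` with `vpq` an edge has `n|A| ≥ 2δ`. Let `L`, `M` be the
links of `v`, `p`. If `q ∈ A`, `qr ∈ L`, `rs ∈ L ∩ M` and `sq ∈ M`, then `v r s p q` is a tight
5-cycle. Excluding such triangles bounds the ordered edge count of `L` and `M` on `A ∪ W` by `(|A| +
|W|)² + |W|²` (`sum_pairMult_le`), where `W` is the rest. With `y = 2δ/n²` this reads `2y ≤ 1 + (1 -
y)² + O(1/n)`, and `2 - √2` is the smaller root of the limiting equation.

Limit. Any two vertices of the tight 5-cycle share an edge, so homomorphisms from it into a 3-graph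
are injective and blow-ups preserve an uncovered vertex. Hence `2c₁(n)/n²` tends to its supremum.

Lower bound. Split the vertices other than `v` into colour classes in ratio 2:1. Edges at `v` have
their other two vertices of one colour; edges off `v` are not monochromatic. A tight 5-cycle `v a b
c d` would give `a, b, c, d` one colour, yet `abc` is an edge. -/

open Classical in
/-- The ordered pairs `(x, y)` such that `{u, x, y}` is an edge of `G`. -/
noncomputable def linkPairs {α : Type*} [Fintype α] (G : Hypergraph α) (u : α) : Finset (α × α) :=
  Finset.univ.filter fun p => ({u, p.1, p.2} : Set α) ∈ G.edgeSet

theorem mem_linkPairs {α : Type*} [Fintype α] {G : Hypergraph α} {u : α} {p : α × α} :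
    p ∈ G.linkPairs u ↔ ({u, p.1, p.2} : Set α) ∈ G.edgeSet := by
  simp [linkPairs]

theorem encard_triple {α : Type*} {x y z : α} :
    ({x, y, z} : Set α).encard = 3 ↔ x ≠ y ∧ x ≠ z ∧ y ≠ z := by
  have hp : ∀ a b : α, ({a, b} : Set α).encard ≠ 3 := by
    intro a b h
    have := Set.encard_insert_le {b} a
    rw [h, Set.encard_singleton] at this
    norm_num at this
  constructor
  · intro h
    refine ⟨?_, ?_, ?_⟩ <;> rintro rfl
    · exact hp x z (by simpa using h)
    · exact hp y x (by simpa using h)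
    · exact hp x y (by simpa using h)
  · rintro ⟨h1, h2, h3⟩
    exact Set.encard_eq_three.2 ⟨x, y, z, h1, h2, h3, rfl⟩

theorem IsUniform.ne_of_mem {α : Type*} {G : Hypergraph α} (hG : G.IsUniform 3) {x y z : α}
    (h : ({x, y, z} : Set α) ∈ G.edgeSet) : x ≠ y ∧ x ≠ z ∧ y ≠ z :=
  encard_triple.1 (by simpa using hG _ h)

/-- Each pair in the neighbourhood of `u` is counted in both orders. Ordered pairs turn degrees into
double sums. -/
theorem IsUniform.card_linkPairs {α : Type*} [Fintype α] {G : Hypergraph α} (hG : G.IsUniform 3)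
    (u : α) : (G.linkPairs u).card = 2 * G.degree {u} := by
  classical
  have hmaps : ∀ p ∈ G.linkPairs u, ({p.1, p.2} : Set α) ∈ (G.neighborhood {u}).toFinset := by
    intro p hp
    rw [mem_linkPairs] at hp
    have hne := hG.ne_of_mem hp
    refine Set.mem_toFinset.2 ⟨?_, by rwa [Set.singleton_union]⟩
    simpa using ⟨hne.1, hne.2.1⟩
  rw [Finset.card_eq_sum_card_fiberwise hmaps, degree, Set.ncard_eq_toFinset_card',
    Finset.sum_const_nat (m := 2), mul_comm]
  intro T hT
  rw [Set.mem_toFinset] at hT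
  obtain ⟨hd, hT⟩ := hT
  have h3 : ({u} ∪ T : Set α).encard = 3 := by simpa using hG _ hT
  rw [Set.encard_union_eq hd, Set.encard_singleton] at h3
  have h2 : T.encard = 2 := by
    have : (1 : ℕ∞) + T.encard = 1 + 2 := by rw [h3]; norm_num
    exact WithTop.add_left_cancel ENat.one_ne_top this
  obtain ⟨x, y, hxy, rfl⟩ := Set.encard_eq_two.1 h2
  have : (G.linkPairs u).filter (fun p => ({p.1, p.2} : Set α) = {x, y}) = {(x, y), (y, x)} := by
    ext ⟨a, b⟩
    simp only [Finset.mem_filter, mem_linkPairs, Finset.mem_insert, Finset.mem_singleton,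
      Prod.mk.injEq, Set.pair_eq_pair_iff]
    constructor
    · exact fun h => h.2
    · rintro (⟨rfl, rfl⟩ | ⟨rfl, rfl⟩)
      · exact ⟨by rwa [Set.singleton_union] at hT, Or.inl ⟨rfl, rfl⟩⟩
      · refine ⟨?_, Or.inr ⟨rfl, rfl⟩⟩
        rw [Set.pair_comm]
        rwa [Set.singleton_union] at hT
  rw [this, Finset.card_pair (by simpa using fun h _ => hxy h)]

theorem minDegree_one_le {α : Type*} {G : Hypergraph α} (hV : G.vertexSet = Set.univ) (u : α) :
    G.minDegree 1 ≤ G.degree {u} :=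
  Nat.sInf_le ⟨{u}, by simp [hV], by simp, rfl⟩

theorem le_minDegree_one {α : Type*} [Nonempty α] {G : Hypergraph α} (hV : G.vertexSet = Set.univ)
    {d : ℕ} (h : ∀ u, d ≤ G.degree {u}) : d ≤ G.minDegree 1 := by
  obtain ⟨u⟩ := ‹Nonempty α›
  refine le_csInf ⟨_, {u}, by simp [hV], by simp, rfl⟩ ?_
  rintro _ ⟨S, -, hS, rfl⟩
  obtain ⟨w, rfl⟩ := Set.encard_eq_one.1 (by simpa using hS)
  exact h w

theorem IsUniform.two_mul_minDegree_le {n : ℕ} {G : Hypergraph (Fin n)} (hG : G.IsUniform 3)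
    (hV : G.vertexSet = Set.univ) (u : Fin n) : 2 * G.minDegree 1 ≤ (G.linkPairs u).card := by
  rw [hG.card_linkPairs]
  exact Nat.mul_le_mul_left _ (minDegree_one_le hV u)

/-! ### The threshold as an attained maximum -/

section Threshold

variable {β : Type*} {F : Hypergraph β} {n : ℕ}

theorem two_mul_minDegree_le_sq [NeZero n] {G : Hypergraph (Fin n)} (hG : G.IsUniform 3)
    (hV : G.vertexSet = Set.univ) : 2 * G.minDegree 1 ≤ n ^ 2 := by
  refine (hG.two_mul_minDegree_le hV 0).trans ((Finset.card_le_univ _).trans ?_)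
  simp [sq]

theorem bddAbove_minDegree [NeZero n] : BddAbove {d | ∃ G : Hypergraph (Fin n),
    G.vertexSet = Set.univ ∧ G.IsUniform 3 ∧ ¬ HasCovering F G ∧ G.minDegree 1 = d} := by
  refine ⟨n ^ 2, ?_⟩
  rintro _ ⟨G, hV, hG, -, rfl⟩
  have := two_mul_minDegree_le_sq hG hV
  omega

theorem le_two_mul_coveringThreshold [NeZero n] {G : Hypergraph (Fin n)}
    (hV : G.vertexSet = Set.univ) (hG : G.IsUniform 3) (hc : ¬ HasCovering F G) {d : ℕ}
    (hd : ∀ u, d ≤ (G.linkPairs u).card) : d ≤ 2 * coveringThreshold 3 1 n F := by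
  -- This is `d / 2` rounded up, so nothing is lost when doubling back.
  have h1 : (d + 1) / 2 ≤ G.minDegree 1 := by
    refine le_minDegree_one hV fun u => ?_
    have := hd u
    rw [hG.card_linkPairs] at this
    omega
  have h2 : G.minDegree 1 ≤ coveringThreshold 3 1 n F :=
    le_csSup bddAbove_minDegree ⟨G, hV, hG, hc, rfl⟩
  omega

theorem exists_minDegree_eq_coveringThreshold [NeZero n] (hF : F.edgeSet.Nonempty) :
    ∃ G : Hypergraph (Fin n), G.vertexSet = Set.univ ∧ G.IsUniform 3 ∧ ¬ HasCovering F G ∧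
      G.minDegree 1 = coveringThreshold 3 1 n F := by
  refine Nat.sSup_mem ?_ (bddAbove_minDegree (F := F) (n := n))
  -- The edgeless 3-graph shows that the supremum is over a nonempty set.
  refine ⟨_, ⟨Set.univ, ∅, by simp⟩, rfl, ?_, ?_, rfl⟩
  · intro e he
    exact absurd he (Set.notMem_empty e)
  · intro h
    obtain ⟨f, ⟨-, -, hf⟩, -⟩ := h 0 (Set.mem_univ _)
    obtain ⟨e, he⟩ := hF
    exact Set.notMem_empty _ (hf e he)

end Threshold

/-! ### Copies of the tight 5-cycle -/

section TightCycle

variable {α : Type*} {G : Hypergraph α}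

theorem mem_edgeSet_tightCycle {e : Set (ZMod 5)} :
    e ∈ (tightCycle 3 5).edgeSet ↔ ∃ i : ZMod 5, e = {i, i + 1, i + 2} := by
  have h : ∀ i : ZMod 5, (fun j : ℕ => i + (j : ZMod 5)) '' Set.Iio 3 = {i, i + 1, i + 2} := by
    intro i
    have : (Set.Iio 3 : Set ℕ) = {0, 1, 2} := by ext j; simp; omega
    rw [this, Set.image_insert_eq, Set.image_pair]
    simp
  change (∃ i : ZMod 5, e = _) ↔ _
  simp only [h]

/-- Injectivity is automatic: two distinct residues modulo 5 differ by ±1 or ±2, so they share an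
edge, whose image has three distinct vertices. -/
theorem isCopy_tightCycle (hV : G.vertexSet = Set.univ) (hG : G.IsUniform 3) {f : ZMod 5 → α} :
    IsCopy (tightCycle 3 5) G f ↔ ∀ i, ({f i, f (i + 1), f (i + 2)} : Set α) ∈ G.edgeSet := by
  constructor
  · rintro ⟨-, -, h⟩ i
    have := h _ (mem_edgeSet_tightCycle.2 ⟨i, rfl⟩)
    rwa [Set.image_insert_eq, Set.image_pair] at this
  · intro h
    refine ⟨?_, fun _ _ => hV ▸ Set.mem_univ _, ?_⟩
    · intro i _ j _ hij
      by_contra hne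
      have key : ∀ i j : ZMod 5, i ≠ j → j = i + 1 ∨ j = i + 2 ∨ i = j + 1 ∨ i = j + 2 := by
        decide
      have hi := hG.ne_of_mem (h i)
      have hj := hG.ne_of_mem (h j)
      rcases key i j hne with e | e | e | e
      · exact hi.1 (e ▸ hij)
      · exact hi.2.1 (e ▸ hij)
      · exact hj.1 (e ▸ hij.symm)
      · exact hj.2.1 (e ▸ hij.symm)
    · intro e he
      obtain ⟨i, rfl⟩ := mem_edgeSet_tightCycle.1 he
      rw [Set.image_insert_eq, Set.image_pair]
      exact h i

theorem not_hasCovering_tightCycle (hV : G.vertexSet = Set.univ) (hG : G.IsUniform 3) :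
    ¬ HasCovering (tightCycle 3 5) G ↔ ∃ v, ∀ f : ZMod 5 → α,
      (∀ i, ({f i, f (i + 1), f (i + 2)} : Set α) ∈ G.edgeSet) → ∀ i, f i ≠ v := by
  have hF : (tightCycle 3 5).vertexSet = Set.univ := rfl
  simp only [HasCovering, isCopy_tightCycle hV hG, hV, hF, Set.mem_univ, true_implies,
    Set.image_univ, Set.mem_range]
  push Not
  rfl

end TightCycle

end Hypergraph

/-! ### Edge count for two graphs without a forbidden triangle -/

section TwoGraphs

variable {α : Type*}

theorem sum_sum_insert_insert [DecidableEq α] {m : α → α → ℕ} (hs : ∀ x y, m x y = m y x) (h0 : ∀ x, m x x = 0)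
    {r s : α} {T : Finset α} (hr : r ∉ T) (hs' : s ∉ T) (hrs : r ≠ s) :
    ∑ x ∈ insert r (insert s T), ∑ y ∈ insert r (insert s T), m x y =
      ∑ x ∈ T, ∑ y ∈ T, m x y + 2 * ∑ u ∈ T, (m u r + m u s) + 2 * m r s := by
  have hr' : r ∉ insert s T := by simp [hrs, hr]
  simp only [Finset.sum_insert hr', Finset.sum_insert hs', Finset.sum_add_distrib, h0, hs s r]
  rw [Finset.sum_congr rfl fun u _ => hs r u, Finset.sum_congr rfl fun u _ => hs s u]
  ring

variable (L M : SimpleGraph α) [DecidableRel L.Adj] [DecidableRel M.Adj]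

/-- The number of the two graphs `L` and `M` in which `x` and `y` are adjacent. -/
def pairMult (x y : α) : ℕ := (if L.Adj x y then 1 else 0) + (if M.Adj x y then 1 else 0)

theorem pairMult_comm (x y : α) : pairMult L M x y = pairMult L M y x := by
  simp [pairMult, L.adj_comm x y, M.adj_comm x y]

theorem pairMult_self (x : α) : pairMult L M x x = 0 := by simp [pairMult]

theorem pairMult_le (x y : α) : pairMult L M x y ≤ 2 := by
  unfold pairMult; split_ifs <;> omega

variable {L M} in
-- With apex `u`, the triangle and its mirror image forbid one edge from `L` and one from `M` going
-- to different ends of `rs`. The four possible edges thus split into two pairs, each contributing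
-- at most one.
theorem pairMult_add_le_two_of_apex {r s u : α} (hL : L.Adj r s) (hM : M.Adj r s)
    (h : ∀ x y, ¬ (L.Adj u x ∧ L.Adj x y ∧ M.Adj x y ∧ M.Adj y u)) :
    pairMult L M u r + pairMult L M u s ≤ 2 := by
  have h1 : ¬ (L.Adj u r ∧ M.Adj u s) := fun hh => h r s ⟨hh.1, hL, hM, hh.2.symm⟩
  have h2 : ¬ (L.Adj u s ∧ M.Adj u r) := fun hh => h s r ⟨hh.1, hL.symm, hM.symm, hh.2.symm⟩
  clear h
  unfold pairMult
  split_ifs <;> first | omega | (exfalso; tauto)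

variable {L M} in
-- With apex `r`, the triangle `r s u` prevents all four edges from being present.
theorem pairMult_add_le_three {r s u : α} (hL : L.Adj r s)
    (h : ∀ x y, ¬ (L.Adj r x ∧ L.Adj x y ∧ M.Adj x y ∧ M.Adj y r)) :
    pairMult L M u r + pairMult L M u s ≤ 3 := by
  have h1 : ¬ (L.Adj u s ∧ M.Adj u s ∧ M.Adj u r) := fun hh =>
    h s u ⟨hL, hh.1.symm, hh.2.1.symm, hh.2.2⟩
  clear h
  unfold pairMult
  split_ifs <;> first | omega | (exfalso; tauto)

variable {L M} in
-- With both `r` and `s` as apexes, each three of the four possible edges complete a forbidden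
-- triangle.
theorem pairMult_add_le_two {r s u : α} (hL : L.Adj r s) (hM : M.Adj r s)
    (h : ∀ x y, ¬ (L.Adj r x ∧ L.Adj x y ∧ M.Adj x y ∧ M.Adj y r))
    (h' : ∀ x y, ¬ (L.Adj s x ∧ L.Adj x y ∧ M.Adj x y ∧ M.Adj y s)) :
    pairMult L M u r + pairMult L M u s ≤ 2 := by
  have h1 : ¬ (L.Adj u s ∧ M.Adj u s ∧ M.Adj u r) := fun hh =>
    h s u ⟨hL, hh.1.symm, hh.2.1.symm, hh.2.2⟩
  have h2 : ¬ (L.Adj u r ∧ L.Adj u s ∧ M.Adj u s) := fun hh =>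
    h u s ⟨hh.1.symm, hh.2.1, hh.2.2, hM.symm⟩
  have h3 : ¬ (L.Adj u r ∧ M.Adj u r ∧ M.Adj u s) := fun hh =>
    h' r u ⟨hL.symm, hh.1.symm, hh.2.1.symm, hh.2.2⟩
  have h4 : ¬ (L.Adj u s ∧ L.Adj u r ∧ M.Adj u r) := fun hh =>
    h' u r ⟨hh.1.symm, hh.2.1, hh.2.2, hM⟩
  clear h h'
  unfold pairMult
  split_ifs <;> first | omega | (exfalso; tauto)

/-- Two graphs without a triangle `q r s`, `q ∈ A`, such that `q r`, `r s` are edges of the first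
graph and `r s`, `s q` edges of the second, have few edges in total. -/
theorem sum_pairMult_le [DecidableEq α] (k : ℕ) : ∀ A W : Finset α, A.card + W.card = k → Disjoint A W →
    (∀ q ∈ A, ∀ r s, ¬ (L.Adj q r ∧ L.Adj r s ∧ M.Adj r s ∧ M.Adj s q)) →
    ∑ x ∈ A ∪ W, ∑ y ∈ A ∪ W, pairMult L M x y ≤ (A.card + W.card) ^ 2 + W.card ^ 2 := by
  induction k using Nat.strong_induction_on with
  | _ k ih =>
  intro A W hk hd hT
  -- Delete the ends of a doubled edge that meets `A`. If both ends lie in `A`, each remaining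
  -- vertex costs at most 2; otherwise vertices of `A` cost at most 2 and those of `W` at most 3.
  -- The bound decreases by at least the resulting loss.
  by_cases hex : ∃ r ∈ A, ∃ s ∈ A ∪ W, L.Adj r s ∧ M.Adj r s
  · obtain ⟨r, hr, s, hs, hL, hM⟩ := hex
    have hrs : r ≠ s := hL.ne
    have hN : ∀ u ∈ A, pairMult L M u r + pairMult L M u s ≤ 2 := fun u hu =>
      pairMult_add_le_two_of_apex hL hM (hT u hu)
    have hsA : ∀ u, s ∈ A → pairMult L M u r + pairMult L M u s ≤ 2 := fun u hs =>
      pairMult_add_le_two hL hM (hT r hr) (hT s hs)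
    have hsW : ∀ u, pairMult L M u r + pairMult L M u s ≤ 3 := fun u =>
      pairMult_add_le_three hL (hT r hr)
    have hm := pairMult_le L M r s
    by_cases hs2 : s ∈ A
    · obtain ⟨A', hA', rfl⟩ : ∃ A', (r ∉ A' ∧ s ∉ A') ∧ A = insert r (insert s A') := by
        refine ⟨(A.erase r).erase s, by simp, ?_⟩
        rw [Finset.insert_erase (by simp [hs2, hrs.symm]), Finset.insert_erase hr]
      have hcard : (insert r (insert s A')).card = A'.card + 2 := by
        rw [Finset.card_insert_of_notMem (by simp [hrs, hA'.1]),
          Finset.card_insert_of_notMem hA'.2]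
      have hrW : r ∉ W := Finset.disjoint_left.1 hd hr
      have hsW' : s ∉ W := Finset.disjoint_left.1 hd hs2
      have hd' : Disjoint A' W := by
        refine hd.mono_left ?_
        intro x hx; simp [hx]
      have ih' := ih (A'.card + W.card) (by omega) A' W rfl hd'
        (fun q hq => hT q (by simp [hq]))
      have hsum : ∑ u ∈ A' ∪ W, (pairMult L M u r + pairMult L M u s) ≤
          (A'.card + W.card) * 2 := by
        rw [← Finset.card_union_of_disjoint hd', ← smul_eq_mul]
        exact Finset.sum_le_card_nsmul _ _ _ fun u _ => hsA u hs2
      rw [Finset.insert_union, Finset.insert_union, sum_sum_insert_insert (pairMult_comm L M)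
        (pairMult_self L M) (by simp [hA'.1, hrW]) (by simp [hA'.2, hsW']) hrs, hcard]
      nlinarith
    · have hs3 : s ∈ W := by simpa [hs2] using hs
      obtain ⟨A', hA', rfl⟩ : ∃ A', r ∉ A' ∧ A = insert r A' :=
        ⟨A.erase r, by simp, (Finset.insert_erase hr).symm⟩
      obtain ⟨W', hW', rfl⟩ : ∃ W', s ∉ W' ∧ W = insert s W' :=
        ⟨W.erase s, by simp, (Finset.insert_erase hs3).symm⟩
      have hrW : r ∉ insert s W' := Finset.disjoint_left.1 hd hr
      have hd' : Disjoint A' W' :=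
        hd.mono (Finset.subset_insert _ _) (Finset.subset_insert _ _)
      rw [Finset.card_insert_of_notMem hA', Finset.card_insert_of_notMem hW'] at *
      have ih' := ih (A'.card + W'.card) (by omega) A' W' rfl hd'
        (fun q hq => hT q (by simp [hq]))
      have hsum : ∑ u ∈ A' ∪ W', (pairMult L M u r + pairMult L M u s) ≤
          A'.card * 2 + W'.card * 3 := by
        rw [Finset.sum_union hd', ← smul_eq_mul, ← smul_eq_mul]
        exact add_le_add (Finset.sum_le_card_nsmul _ _ _ fun u hu => hN u (by simp [hu]))
          (Finset.sum_le_card_nsmul _ _ _ fun u _ => hsW u)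
      simp only [Finset.mem_insert, not_or] at hrW hs2
      have : insert r A' ∪ insert s W' = insert r (insert s (A' ∪ W')) := by
        rw [Finset.insert_union, Finset.union_insert]
      rw [this, sum_sum_insert_insert (pairMult_comm L M)
        (pairMult_self L M) (by simp [hA', hrW.2]) (by simp [hW', hs2.2]) hrs]
      nlinarith
  -- Now doubled edges lie only inside `W`, giving `|A|² + 2|A||W| + 2|W|²`, which is exactly the
  -- bound.
  · push Not at hex
    have h1 : ∀ x ∈ A, ∀ y ∈ A ∪ W, pairMult L M x y ≤ 1 := by
      intro x hx y hy
      have := hex x hx y hy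
      unfold pairMult
      split_ifs <;> first | omega | (exfalso; tauto)
    have hAA : ∑ x ∈ A, ∑ y ∈ A, pairMult L M x y ≤ A.card * (A.card * 1) := by
      rw [← smul_eq_mul, ← smul_eq_mul]
      exact Finset.sum_le_card_nsmul _ _ _ fun x hx =>
        Finset.sum_le_card_nsmul _ _ _ fun y hy => h1 x hx y (by simp [hy])
    have hAW : ∑ x ∈ A, ∑ y ∈ W, pairMult L M x y ≤ A.card * (W.card * 1) := by
      rw [← smul_eq_mul, ← smul_eq_mul]
      exact Finset.sum_le_card_nsmul _ _ _ fun x hx =>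
        Finset.sum_le_card_nsmul _ _ _ fun y hy => h1 x hx y (by simp [hy])
    have hWW : ∑ x ∈ W, ∑ y ∈ W, pairMult L M x y ≤ W.card * (W.card * 2) := by
      rw [← smul_eq_mul, ← smul_eq_mul]
      exact Finset.sum_le_card_nsmul _ _ _ fun x _ =>
        Finset.sum_le_card_nsmul _ _ _ fun y _ => pairMult_le L M x y
    have hWA : ∑ x ∈ W, ∑ y ∈ A, pairMult L M x y = ∑ x ∈ A, ∑ y ∈ W, pairMult L M x y := by
      rw [Finset.sum_comm]
      exact Finset.sum_congr rfl fun x _ => Finset.sum_congr rfl fun y _ => pairMult_comm L M y x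
    simp only [Finset.sum_union hd, Finset.sum_add_distrib, hWA]
    nlinarith

end TwoGraphs

/-! ### Upper bound for fixed `n` -/

namespace Hypergraph

/-- The link of a vertex `u` of a `3`-graph, as a graph on the same vertices. -/
def linkGraph {α : Type*} {G : Hypergraph α} (hG : G.IsUniform 3) (u : α) : SimpleGraph α where
  Adj x y := ({u, x, y} : Set α) ∈ G.edgeSet
  symm := ⟨fun x y h => by rwa [Set.pair_comm]⟩
  loopless := ⟨fun x h => (hG.ne_of_mem h).2.2 rfl⟩

variable {n : ℕ} {G : Hypergraph (Fin n)}

open Classical in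
-- The term `2 * A.card` pays for the ordered pairs that contain `p`.
theorem card_linkPairs_le (hG : G.IsUniform 3) {u p : Fin n} {A S : Finset (Fin n)}
    (hA : ∀ q, ({u, p, q} : Set (Fin n)) ∈ G.edgeSet → q ∈ A)
    (hS : ∀ x, x ≠ u → x ≠ p → x ∈ S) :
    (G.linkPairs u).card ≤
      (∑ x ∈ S, ∑ y ∈ S, if (linkGraph hG u).Adj x y then 1 else 0) + 2 * A.card := by
  have hsub : G.linkPairs u ⊆ (S ×ˢ S).filter (fun z => (linkGraph hG u).Adj z.1 z.2) ∪
      ({p} ×ˢ A ∪ A ×ˢ {p}) := by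
    rintro ⟨x, y⟩ hxy
    rw [mem_linkPairs] at hxy
    have hne := hG.ne_of_mem hxy
    simp only [Finset.mem_union, Finset.mem_filter, Finset.mem_product, Finset.mem_singleton]
    by_cases hx : x = p
    · subst hx
      exact Or.inr (Or.inl ⟨rfl, hA _ hxy⟩)
    · by_cases hy : y = p
      · subst hy
        exact Or.inr (Or.inr ⟨hA _ (by rwa [Set.pair_comm]), rfl⟩)
      · exact Or.inl ⟨⟨hS x hne.1.symm hx, hS y hne.2.1.symm hy⟩, hxy⟩
  have h1 := Finset.card_le_card hsub
  have h2 := Finset.card_union_le ((S ×ˢ S).filter fun z => (linkGraph hG u).Adj z.1 z.2)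
    ({p} ×ˢ A ∪ A ×ˢ {p})
  have h3 := Finset.card_union_le ({p} ×ˢ A) (A ×ˢ {p})
  simp only [Finset.card_product, Finset.card_singleton] at h3
  rw [Finset.card_filter, Finset.sum_product] at h2
  dsimp only at h2
  omega

open Classical in
theorem card_linkPairs_eq_sum (v : Fin n) : (G.linkPairs v).card =
    ∑ p, (Finset.univ.filter fun q => ({v, p, q} : Set (Fin n)) ∈ G.edgeSet).card := by
  simp only [linkPairs, Finset.card_filter, ← Finset.univ_product_univ, Finset.sum_product]

theorem exists_le_of_not_hasCovering (hV : G.vertexSet = Set.univ) (hG : G.IsUniform 3)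
    (hc : ¬ HasCovering (tightCycle 3 5) G) :
    ∃ a w : ℕ, a + w ≤ n ∧ 2 * G.minDegree 1 ≤ n * a ∧
      4 * G.minDegree 1 ≤ n ^ 2 + w ^ 2 + 4 * n := by
  classical
  obtain ⟨v, hv⟩ := (not_hasCovering_tightCycle hV hG).1 hc
  rcases Nat.eq_zero_or_pos (G.minDegree 1) with h0 | hpos
  · exact ⟨0, 0, by simp [h0]⟩
  have hdv := hG.two_mul_minDegree_le hV v
  -- Averaging: the sizes of these sets over all `p` sum to at least `2δ`.
  have hp : ∃ p, 2 * G.minDegree 1 ≤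
      n * (Finset.univ.filter fun q => ({v, p, q} : Set (Fin n)) ∈ G.edgeSet).card := by
    by_contra! h
    have hlt := Finset.sum_lt_sum_of_nonempty (s := Finset.univ) ⟨v, Finset.mem_univ v⟩
      fun p _ => h p
    rw [← Finset.mul_sum, ← card_linkPairs_eq_sum, Finset.sum_const, Finset.card_univ,
      Fintype.card_fin, smul_eq_mul] at hlt
    exact absurd (Nat.mul_le_mul_left n hdv) (not_le.2 hlt)
  obtain ⟨p, hp⟩ := hp
  set A := Finset.univ.filter fun q => ({v, p, q} : Set (Fin n)) ∈ G.edgeSet with hA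
  have hmemA : ∀ q, q ∈ A ↔ ({v, p, q} : Set (Fin n)) ∈ G.edgeSet := by simp [hA]
  have hvp : v ≠ p := by
    have : 0 < A.card := Nat.pos_of_ne_zero fun h => by rw [h] at hp; omega
    obtain ⟨q, hq⟩ := Finset.card_pos.1 this
    exact (hG.ne_of_mem ((hmemA q).1 hq)).1
  set W := Finset.univ.filter fun x => x ∉ A ∧ x ≠ v ∧ x ≠ p with hW
  have hdisj : Disjoint A W := by
    rw [Finset.disjoint_left]
    intro x hx
    simp [hW, hx]
  have hcard : A.card + W.card ≤ n := by
    rw [← Finset.card_union_of_disjoint hdisj]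
    simpa using Finset.card_le_univ (A ∪ W)
  have hS : ∀ x, x ≠ v → x ≠ p → x ∈ A ∪ W := by
    intro x h1 h2
    by_cases hx : x ∈ A <;> simp [hW, h1, h2, hx]
  have hswap : ∀ q, ({p, v, q} : Set (Fin n)) = {v, p, q} := fun q => Set.insert_comm _ _ _
  have hL := card_linkPairs_le (S := A ∪ W) hG (fun q => (hmemA q).2) hS
  have hM := card_linkPairs_le (S := A ∪ W) (u := p) (p := v) hG
    (fun q => by rw [hswap]; exact (hmemA q).2) (fun x h1 h2 => hS x h2 h1)
  have hmain := sum_pairMult_le (linkGraph hG v) (linkGraph hG p) _ A W rfl hdisj (by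
    rintro q hq r s ⟨h1, h2, h3, h4⟩
    -- The tight cycle has edges `vrs`, `rsp`, `spq`, `pqv`, `qvr`.
    refine hv (![v, r, s, p, q] : Fin 5 → Fin n) ?_ (0 : Fin 5) rfl
    rw [hmemA] at hq
    change ({v, q, r} : Set (Fin n)) ∈ _ at h1
    change ({v, r, s} : Set (Fin n)) ∈ _ at h2
    change ({p, r, s} : Set (Fin n)) ∈ _ at h3
    change ({p, s, q} : Set (Fin n)) ∈ _ at h4
    intro i
    change Fin 5 at i
    fin_cases i
    · exact h2
    · change ({r, s, p} : Set (Fin n)) ∈ _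
      convert h3 using 1
      ext; simp; tauto
    · change ({s, p, q} : Set (Fin n)) ∈ _
      rwa [Set.insert_comm]
    · change ({p, q, v} : Set (Fin n)) ∈ _
      convert hq using 1
      ext; simp; tauto
    · change ({q, v, r} : Set (Fin n)) ∈ _
      rwa [Set.insert_comm])
  simp only [pairMult, Finset.sum_add_distrib] at hmain
  have hdp := hG.two_mul_minDegree_le hV p
  refine ⟨A.card, W.card, hcard, hp, ?_⟩
  -- Each of the two links contributes an error `2 * A.card`, at most `4 * n` together.
  have := Nat.pow_le_pow_left hcard 2
  omega

theorem coveringThreshold_sq_le [NeZero n] {y : ℝ}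
    (hy : y = 2 * (coveringThreshold 3 1 n (tightCycle 3 5) : ℝ) / (n : ℝ) ^ 2) :
    2 * y ≤ 1 + (1 - y) ^ 2 + 4 / n := by
  obtain ⟨G, hV, hG, hc, hd⟩ := exists_minDegree_eq_coveringThreshold (n := n)
    (F := tightCycle 3 5) ⟨_, 0, rfl⟩
  obtain ⟨a, w, h1, h2, h3⟩ := exists_le_of_not_hasCovering hV hG hc
  rw [hd] at h2 h3
  have hn : (0 : ℝ) < n := by exact_mod_cast Nat.pos_of_ne_zero (NeZero.ne n)
  generalize coveringThreshold 3 1 n (tightCycle 3 5) = d at *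
  have h1' : (a + w : ℝ) ≤ n := by exact_mod_cast h1
  have h2' : 2 * (d : ℝ) ≤ n * a := by exact_mod_cast h2
  have h3' : 4 * (d : ℝ) ≤ (n : ℝ) ^ 2 + w ^ 2 + 4 * n := by exact_mod_cast h3
  have hd' : 2 * (d : ℝ) = y * n ^ 2 := by rw [hy]; field_simp
  have hw0 : (0 : ℝ) ≤ w := Nat.cast_nonneg w
  have hya : y * n ≤ a := by
    refine le_of_mul_le_mul_left ?_ hn
    linarith [h2', hd', show (n : ℝ) * (y * n) = y * n ^ 2 by ring]
  have hw : (w : ℝ) ≤ (1 - y) * n := by linarith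
  have hw2 : (w : ℝ) ^ 2 ≤ ((1 - y) * n) ^ 2 := pow_le_pow_left₀ hw0 hw 2
  have : (2 * y) * n ^ 2 ≤ (1 + (1 - y) ^ 2 + 4 / n) * n ^ 2 := by
    have e : (1 + (1 - y) ^ 2 + 4 / n) * (n : ℝ) ^ 2 = n ^ 2 + ((1 - y) * n) ^ 2 + 4 * n := by
      field_simp
    rw [e]
    nlinarith
  exact le_of_mul_le_mul_right this (by positivity)

end Hypergraph

/-! ### Blow-ups -/

namespace Hypergraph

section Blowup

/-- The `3`-graph of all triples that `f` maps onto an edge of `G`. -/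
def blowup {α β : Type*} (G : Hypergraph α) (f : β → α) : Hypergraph β where
  vertexSet := Set.univ
  edgeSet := {e | e.encard = 3 ∧ f '' e ∈ G.edgeSet}
  subset_vertexSet_of_mem_edgeSet' := fun _ _ => Set.subset_univ _

theorem isUniform_blowup {α β : Type*} (G : Hypergraph α) (f : β → α) :
    (G.blowup f).IsUniform 3 := fun _ he => he.1

theorem triple_mem_blowup {α β : Type*} {G : Hypergraph α} (hG : G.IsUniform 3) {f : β → α}
    {x y z : β} : ({x, y, z} : Set β) ∈ (G.blowup f).edgeSet ↔
      ({f x, f y, f z} : Set α) ∈ G.edgeSet := by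
  change _ ∧ _ ↔ _
  rw [Set.image_insert_eq, Set.image_pair]
  refine ⟨fun h => h.2, fun h => ⟨?_, h⟩⟩
  obtain ⟨h1, h2, h3⟩ := hG.ne_of_mem h
  exact encard_triple.2 ⟨ne_of_apply_ne f h1, ne_of_apply_ne f h2, ne_of_apply_ne f h3⟩

/-- A tight 5-cycle through a preimage `w` of the uncovered vertex projects along `f` to one through
that vertex. -/
theorem not_hasCovering_blowup {α β : Type*} {G : Hypergraph α} (hV : G.vertexSet = Set.univ)
    (hG : G.IsUniform 3) {f : β → α} (hf : Function.Surjective f)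
    (hc : ¬ HasCovering (tightCycle 3 5) G) : ¬ HasCovering (tightCycle 3 5) (G.blowup f) := by
  rw [not_hasCovering_tightCycle hV hG] at hc
  rw [not_hasCovering_tightCycle rfl (isUniform_blowup G f)]
  obtain ⟨v, hv⟩ := hc
  obtain ⟨w, rfl⟩ := hf v
  refine ⟨w, fun g hg i hi => hv (f ∘ g) (fun j => ?_) i (congrArg f hi)⟩
  exact (triple_mem_blowup (f := f) hG).1 (hg j)

theorem coveringThreshold_blowup_le {n N : ℕ} [NeZero n] [NeZero N] (hnN : n ≤ N) :
    2 * coveringThreshold 3 1 n (tightCycle 3 5) * (N / n) ^ 2 ≤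
      2 * coveringThreshold 3 1 N (tightCycle 3 5) := by
  obtain ⟨G, hV, hG, hc, hd⟩ := exists_minDegree_eq_coveringThreshold (n := n)
    (F := tightCycle 3 5) ⟨_, 0, rfl⟩
  have hn : 0 < n := Nat.pos_of_ne_zero (NeZero.ne n)
  let f : Fin N → Fin n := fun i => ⟨i % n, Nat.mod_lt _ hn⟩
  have hlt : ∀ (a : Fin n) (i : Fin (N / n)), (i : ℕ) * n + a < N := by
    intro a i
    have h1 : ((i : ℕ) + 1) * n ≤ N / n * n := Nat.mul_le_mul_right _ i.2
    have h2 := Nat.div_mul_le_self N n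
    have h3 := a.2
    nlinarith
  -- `g a i` is the `i`-th number congruent to `a`; every residue class has at least `N / n`
  -- members, so link pairs multiply by at least `(N / n) ^ 2`.
  let g : Fin n → Fin (N / n) → Fin N := fun a i => ⟨i * n + a, hlt a i⟩
  have hfg : ∀ a i, f (g a i) = a := by
    intro a i
    apply Fin.ext
    simp [f, g, Nat.mod_eq_of_lt a.2]
  have hg : ∀ a i b j, g a i = g b j → a = b ∧ i = j := by
    intro a i b j h
    have hab : a = b := by rw [← hfg a i, h, hfg]
    subst hab
    refine ⟨rfl, Fin.ext ?_⟩
    have : (i : ℕ) * n + a = j * n + a := congrArg Fin.val h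
    exact Nat.eq_of_mul_eq_mul_right hn (by omega)
  have hf : Function.Surjective f := fun a =>
    ⟨g a ⟨0, Nat.div_pos hnN hn⟩, hfg _ _⟩
  refine le_two_mul_coveringThreshold (G := G.blowup f) rfl (isUniform_blowup G f)
    (not_hasCovering_blowup hV hG hf hc) fun u => ?_
  have hu := hG.two_mul_minDegree_le hV (f u)
  rw [hd] at hu
  refine (Nat.mul_le_mul_right _ hu).trans ?_
  have hcard : (G.linkPairs (f u)).card * (N / n) ^ 2 =
      ((G.linkPairs (f u)) ×ˢ (Finset.univ : Finset (Fin (N / n) × Fin (N / n)))).card := by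
    simp [sq]
  rw [hcard]
  refine Finset.card_le_card_of_injOn (fun z => (g z.1.1 z.2.1, g z.1.2 z.2.2)) ?_ ?_
  · rintro ⟨⟨a, b⟩, i, j⟩ hz
    simp only [Finset.coe_product, Set.mem_prod, Finset.mem_coe, mem_linkPairs] at hz
    simp only [Finset.mem_coe, mem_linkPairs]
    rw [triple_mem_blowup hG, hfg, hfg]
    exact hz.1
  · rintro ⟨⟨a, b⟩, i, j⟩ - ⟨⟨a', b'⟩, i', j'⟩ - h
    simp only [Prod.mk.injEq] at h
    obtain ⟨h1, h2⟩ := hg _ _ _ _ h.1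
    obtain ⟨h3, h4⟩ := hg _ _ _ _ h.2
    simp [h1, h2, h3, h4]

end Blowup

/-! ### The two-coloured construction for 5/9 -/

section Construction

/-- The triples containing `v` and two further vertices of the same colour, and the triples
avoiding `v` that are not monochromatic. -/
def crossing {α : Type*} (v : α) (c : α → Prop) : Hypergraph α where
  vertexSet := Set.univ
  edgeSet := {e | e.encard = 3 ∧
    ((v ∈ e ∧ ∀ x ∈ e, ∀ y ∈ e, x ≠ v → y ≠ v → (c x ↔ c y)) ∨
      (v ∉ e ∧ ∃ x ∈ e, ∃ y ∈ e, c x ∧ ¬ c y))}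
  subset_vertexSet_of_mem_edgeSet' := fun _ _ => Set.subset_univ _

theorem isUniform_crossing {α : Type*} (v : α) (c : α → Prop) : (crossing v c).IsUniform 3 :=
  fun _ he => he.1

theorem apex_mem_crossing {α : Type*} {v x y : α} {c : α → Prop} :
    ({v, x, y} : Set α) ∈ (crossing v c).edgeSet ↔
      (v ≠ x ∧ v ≠ y ∧ x ≠ y) ∧ (c x ↔ c y) := by
  change _ ∧ _ ↔ _
  rw [encard_triple]
  refine and_congr_right ?_
  rintro ⟨h1, h2, -⟩
  simp [h1.symm, h2.symm]
  tauto

theorem mem_crossing {α : Type*} {v x y z : α} {c : α → Prop} (hx : x ≠ v) (hy : y ≠ v)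
    (hz : z ≠ v) : ({x, y, z} : Set α) ∈ (crossing v c).edgeSet ↔
      (x ≠ y ∧ x ≠ z ∧ y ≠ z) ∧ ¬ ((c x ↔ c y) ∧ (c y ↔ c z)) := by
  change _ ∧ _ ↔ _
  rw [encard_triple]
  refine and_congr_right fun _ => ?_
  simp [hx.symm, hy.symm, hz.symm]
  tauto

theorem not_hasCovering_crossing {α : Type*} (v : α) (c : α → Prop) :
    ¬ HasCovering (tightCycle 3 5) (crossing v c) := by
  rw [not_hasCovering_tightCycle rfl (isUniform_crossing v c)]
  refine ⟨v, fun f hf i hi => ?_⟩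
  have h0 := hf i
  have h1 := hf (i + 1)
  have h3 := hf (i + 3)
  have h4 := hf (i + 4)
  have e : (1 + 1 : ZMod 5) = 2 ∧ (1 + 2 : ZMod 5) = 3 ∧ (3 + 1 : ZMod 5) = 4 ∧
      (3 + 2 : ZMod 5) = 0 ∧ (4 + 1 : ZMod 5) = 0 ∧ (4 + 2 : ZMod 5) = 1 := by decide
  simp only [add_assoc, e, add_zero, hi] at h0 h1 h3 h4
  have e3 : ({f (i + 3), f (i + 4), v} : Set α) = {v, f (i + 3), f (i + 4)} := by
    ext; simp; tauto
  rw [e3, apex_mem_crossing] at h3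
  rw [Set.insert_comm, apex_mem_crossing] at h4
  rw [apex_mem_crossing] at h0
  rw [mem_crossing h0.1.1.symm h0.1.2.1.symm h3.1.1.symm] at h1
  tauto

/-- The ratio 2:1 balances `v` against `X`: if `X` has proportion `t`, their link densities are `t²
+ (1 - t)²` and `1 - t²`, equal to 5/9 at `t = 2/3`. Vertices of `Y` have larger links. For `u ≠ v`,
pairs containing `v` are dropped from the count. -/
theorem le_card_linkPairs_crossing {α : Type*} [Fintype α] [DecidableEq α] {v : α}
    {c : α → Prop} {X Y : Finset α} (hX : ∀ x ∈ X, x ≠ v ∧ c x) (hY : ∀ y ∈ Y, y ≠ v ∧ ¬ c y)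
    (hall : ∀ u, u = v ∨ u ∈ X ∨ u ∈ Y) {m : ℕ} (hXm : X.card = 2 * m) (hYm : Y.card = m)
    (u : α) : 5 * m ^ 2 - 3 * m ≤ ((crossing v c).linkPairs u).card := by
  have hXY : Disjoint X Y := Finset.disjoint_left.2 fun x hx hy => (hY x hy).2 (hX x hx).2
  have hdisj : Disjoint X.offDiag Y.offDiag := by
    rw [Finset.disjoint_left]
    rintro ⟨x, y⟩ h1 h2
    rw [Finset.mem_offDiag] at h1 h2
    exact Finset.disjoint_left.1 hXY h1.1 h2.1
  have hsq : m ≤ m ^ 2 := Nat.le_self_pow two_ne_zero m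
  rcases hall u with rfl | hu | hu
  · have hsub : X.offDiag ∪ Y.offDiag ⊆ (crossing u c).linkPairs u := by
      rintro ⟨x, y⟩ h
      rw [mem_linkPairs, apex_mem_crossing]
      simp only [Finset.mem_union, Finset.mem_offDiag] at h
      rcases h with ⟨h1, h2, h3⟩ | ⟨h1, h2, h3⟩
      · exact ⟨⟨(hX x h1).1.symm, (hX y h2).1.symm, h3⟩, by simp [(hX x h1).2, (hX y h2).2]⟩
      · exact ⟨⟨(hY x h1).1.symm, (hY y h2).1.symm, h3⟩, by simp [(hY x h1).2, (hY y h2).2]⟩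
    have := Finset.card_le_card hsub
    rw [Finset.card_union_of_disjoint hdisj, Finset.offDiag_card, Finset.offDiag_card, hXm, hYm]
      at this
    refine le_trans ?_ this
    have e1 : 2 * m * (2 * m) = 4 * m ^ 2 := by ring
    have e2 : m * m = m ^ 2 := by ring
    omega
  · have hsub : Y.offDiag ∪ ((X.erase u) ×ˢ Y ∪ Y ×ˢ (X.erase u)) ⊆
        (crossing v c).linkPairs u := by
      rintro ⟨x, y⟩ h
      rw [mem_linkPairs]
      simp only [Finset.mem_union, Finset.mem_offDiag, Finset.mem_product, Finset.mem_erase] at h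
      have hu' := hX u hu
      rcases h with ⟨h1, h2, h3⟩ | ⟨⟨h0, h1⟩, h2⟩ | ⟨h1, h0, h2⟩
      · have hx := hY x h1
        have hy := hY y h2
        rw [mem_crossing hu'.1 hx.1 hy.1]
        exact ⟨⟨fun e => hx.2 (e ▸ hu'.2), fun e => hy.2 (e ▸ hu'.2), h3⟩, by tauto⟩
      · have hx := hX x h1
        have hy := hY y h2
        rw [mem_crossing hu'.1 hx.1 hy.1]
        exact ⟨⟨Ne.symm h0, fun e => hy.2 (e ▸ hu'.2), fun e => hy.2 (e ▸ hx.2)⟩, by tauto⟩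
      · have hx := hY x h1
        have hy := hX y h2
        rw [mem_crossing hu'.1 hx.1 hy.1]
        exact ⟨⟨fun e => hx.2 (e ▸ hu'.2), Ne.symm h0, fun e => hx.2 (e ▸ hy.2)⟩, by tauto⟩
    have hd1 : Disjoint ((X.erase u) ×ˢ Y) (Y ×ˢ (X.erase u)) := by
      rw [Finset.disjoint_left]
      rintro ⟨x, y⟩ h1 h2
      simp only [Finset.mem_product, Finset.mem_erase] at h1 h2
      exact Finset.disjoint_left.1 hXY h1.1.2 h2.1
    have hd2 : Disjoint Y.offDiag ((X.erase u) ×ˢ Y ∪ Y ×ˢ (X.erase u)) := by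
      rw [Finset.disjoint_left]
      rintro ⟨x, y⟩ h1 h2
      simp only [Finset.mem_union, Finset.mem_offDiag, Finset.mem_product, Finset.mem_erase]
        at h1 h2
      rcases h2 with h2 | h2
      · exact Finset.disjoint_left.1 hXY h2.1.2 h1.1
      · exact Finset.disjoint_left.1 hXY h2.2.2 h1.2.1
    have := Finset.card_le_card hsub
    rw [Finset.card_union_of_disjoint hd2, Finset.card_union_of_disjoint hd1, Finset.offDiag_card,
      Finset.card_product, Finset.card_product, Finset.card_erase_of_mem hu, hXm, hYm] at this
    refine le_trans ?_ this
    have e1 : (2 * m - 1) * m = 2 * m ^ 2 - m := by rw [Nat.sub_mul]; ring_nf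
    have e3 : m * (2 * m - 1) = 2 * m ^ 2 - m := by rw [mul_comm, e1]
    have e2 : m * m = m ^ 2 := by ring
    omega
  · have hsub : X.offDiag ∪ ((Y.erase u) ×ˢ X ∪ X ×ˢ (Y.erase u)) ⊆
        (crossing v c).linkPairs u := by
      rintro ⟨x, y⟩ h
      rw [mem_linkPairs]
      simp only [Finset.mem_union, Finset.mem_offDiag, Finset.mem_product, Finset.mem_erase] at h
      have hu' := hY u hu
      rcases h with ⟨h1, h2, h3⟩ | ⟨⟨h0, h1⟩, h2⟩ | ⟨h1, h0, h2⟩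
      · have hx := hX x h1
        have hy := hX y h2
        rw [mem_crossing hu'.1 hx.1 hy.1]
        exact ⟨⟨fun e => hu'.2 (e ▸ hx.2), fun e => hu'.2 (e ▸ hy.2), h3⟩, by tauto⟩
      · have hx := hY x h1
        have hy := hX y h2
        rw [mem_crossing hu'.1 hx.1 hy.1]
        exact ⟨⟨Ne.symm h0, fun e => hu'.2 (e ▸ hy.2), fun e => hx.2 (e ▸ hy.2)⟩, by tauto⟩
      · have hx := hX x h1
        have hy := hY y h2
        rw [mem_crossing hu'.1 hx.1 hy.1]
        exact ⟨⟨fun e => hu'.2 (e ▸ hx.2), Ne.symm h0, fun e => hy.2 (e ▸ hx.2)⟩, by tauto⟩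
    have hd1 : Disjoint ((Y.erase u) ×ˢ X) (X ×ˢ (Y.erase u)) := by
      rw [Finset.disjoint_left]
      rintro ⟨x, y⟩ h1 h2
      simp only [Finset.mem_product, Finset.mem_erase] at h1 h2
      exact Finset.disjoint_left.1 hXY h2.1 h1.1.2
    have hd2 : Disjoint X.offDiag ((Y.erase u) ×ˢ X ∪ X ×ˢ (Y.erase u)) := by
      rw [Finset.disjoint_left]
      rintro ⟨x, y⟩ h1 h2
      simp only [Finset.mem_union, Finset.mem_offDiag, Finset.mem_product, Finset.mem_erase]
        at h1 h2
      rcases h2 with h2 | h2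
      · exact Finset.disjoint_left.1 hXY h1.1 h2.1.2
      · exact Finset.disjoint_left.1 hXY h1.2.1 h2.2.2
    have := Finset.card_le_card hsub
    rw [Finset.card_union_of_disjoint hd2, Finset.card_union_of_disjoint hd1, Finset.offDiag_card,
      Finset.card_product, Finset.card_product, Finset.card_erase_of_mem hu, hXm, hYm] at this
    refine le_trans ?_ this
    have e1 : (m - 1) * (2 * m) = 2 * m ^ 2 - 2 * m := by rw [Nat.sub_mul]; ring_nf
    have e3 : 2 * m * (m - 1) = 2 * m ^ 2 - 2 * m := by rw [mul_comm, e1]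
    have e2 : 2 * m * (2 * m) = 4 * m ^ 2 := by ring
    omega

theorem le_coveringThreshold_three_mul_add_one (m : ℕ) :
    5 * m ^ 2 - 3 * m ≤ 2 * coveringThreshold 3 1 (3 * m + 1) (tightCycle 3 5) := by
  let v : Fin (3 * m + 1) := 0
  -- The colour of `v = 0` is immaterial.
  let c : Fin (3 * m + 1) → Prop := fun i => (i : ℕ) ≤ 2 * m
  let X : Finset (Fin (3 * m + 1)) := Finset.univ.filter fun i => 1 ≤ (i : ℕ) ∧ (i : ℕ) ≤ 2 * m
  let Y : Finset (Fin (3 * m + 1)) := Finset.univ.filter fun i => 2 * m < (i : ℕ)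
  have hX : X.card = 2 * m := by
    rw [← Finset.card_map Fin.valEmbedding]
    have : X.map Fin.valEmbedding = Finset.Icc 1 (2 * m) := by
      ext i
      simp only [X, Finset.mem_map, Finset.mem_filter, Finset.mem_univ, true_and,
        Fin.valEmbedding_apply, Finset.mem_Icc]
      exact ⟨by rintro ⟨a, ha, rfl⟩; exact ha, fun h => ⟨⟨i, by omega⟩, h, rfl⟩⟩
    rw [this]; simp
  have hY : Y.card = m := by
    rw [← Finset.card_map Fin.valEmbedding]
    have : Y.map Fin.valEmbedding = Finset.Ioc (2 * m) (3 * m) := by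
      ext i
      simp only [Y, Finset.mem_map, Finset.mem_filter, Finset.mem_univ, true_and,
        Fin.valEmbedding_apply, Finset.mem_Ioc]
      exact ⟨by rintro ⟨a, ha, rfl⟩; exact ⟨ha, by omega⟩, fun h => ⟨⟨i, by omega⟩, h.1, rfl⟩⟩
    rw [this, Nat.card_Ioc]; omega
  have hv : ∀ u : Fin (3 * m + 1), u = v ↔ (u : ℕ) = 0 := fun u => Fin.ext_iff
  refine le_two_mul_coveringThreshold (G := crossing v c) rfl (isUniform_crossing v c)
    (not_hasCovering_crossing v c)
    (le_card_linkPairs_crossing (X := X) (Y := Y) ?_ ?_ ?_ hX hY)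
  · intro x hx
    simp only [X, Finset.mem_filter, Finset.mem_univ, true_and] at hx
    exact ⟨fun h => by rw [hv] at h; omega, hx.2⟩
  · intro y hy
    simp only [Y, Finset.mem_filter, Finset.mem_univ, true_and] at hy
    exact ⟨fun h => by rw [hv] at h; omega, not_le.2 hy⟩
  · intro u
    simp only [hv, X, Y, Finset.mem_filter, Finset.mem_univ, true_and]
    omega

end Construction

end Hypergraph

/-! ### The limit and its bounds -/

namespace Hypergraph

/-- Twice the vertex-degree covering threshold of the tight `5`-cycle, divided by `n ^ 2`. -/
noncomputable def normalizedThreshold (n : ℕ) : ℝ :=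
  2 * (coveringThreshold 3 1 n (tightCycle 3 5) : ℝ) / (n : ℝ) ^ 2

theorem normalizedThreshold_le_one (n : ℕ) : normalizedThreshold n ≤ 1 := by
  rcases Nat.eq_zero_or_pos n with rfl | hn
  · simp [normalizedThreshold]
  have : NeZero n := ⟨hn.ne'⟩
  obtain ⟨G, hV, hG, -, hd⟩ := exists_minDegree_eq_coveringThreshold (n := n)
    (F := tightCycle 3 5) ⟨_, 0, rfl⟩
  have h := two_mul_minDegree_le_sq hG hV
  rw [hd] at h
  refine div_le_one_of_le₀ ?_ (by positivity)
  exact_mod_cast h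

theorem bddAbove_normalizedThreshold : BddAbove (Set.range normalizedThreshold) :=
  ⟨1, by rintro _ ⟨n, rfl⟩; exact normalizedThreshold_le_one n⟩

theorem normalizedThreshold_mul_le {n N : ℕ} (hn : 0 < n) (hnN : n ≤ N) :
    normalizedThreshold n * ((⌊(N : ℝ) / n⌋₊ : ℝ) / ((N : ℝ) / n)) ^ 2 ≤
      normalizedThreshold N := by
  have : NeZero n := ⟨hn.ne'⟩
  have : NeZero N := ⟨(hn.trans_le hnN).ne'⟩
  have h : 2 * (coveringThreshold 3 1 n (tightCycle 3 5) : ℝ) * ((N / n : ℕ) : ℝ) ^ 2 ≤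
      2 * coveringThreshold 3 1 N (tightCycle 3 5) := by
    exact_mod_cast coveringThreshold_blowup_le hnN
  have hn' : (0 : ℝ) < n := by exact_mod_cast hn
  have hN' : (0 : ℝ) < N := by exact_mod_cast hn.trans_le hnN
  rw [Nat.floor_div_eq_div, normalizedThreshold, normalizedThreshold,
    le_div_iff₀ (by positivity)]
  refine le_trans (le_of_eq ?_) h
  field_simp

theorem tendsto_normalizedThreshold :
    Tendsto normalizedThreshold atTop (𝓝 (⨆ n, normalizedThreshold n)) := by
  refine tendsto_order.2 ⟨fun b hb => ?_, fun b hb =>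
    Eventually.of_forall fun N => (le_ciSup bddAbove_normalizedThreshold N).trans_lt hb⟩
  obtain ⟨n, hn⟩ := exists_lt_of_lt_ciSup hb
  rcases Nat.eq_zero_or_pos n with rfl | hpos
  -- For `n = 0` division by zero gives the value 0, so nonnegativity suffices.
  · refine Eventually.of_forall fun N => lt_of_lt_of_le hn ?_
    have : normalizedThreshold 0 = 0 := by simp [normalizedThreshold]
    rw [this]
    unfold normalizedThreshold
    positivity
  have hlim : Tendsto (fun N : ℕ => normalizedThreshold n *
      ((⌊(N : ℝ) / n⌋₊ : ℝ) / ((N : ℝ) / n)) ^ 2) atTop (𝓝 (normalizedThreshold n * 1 ^ 2)) := by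
    refine Tendsto.const_mul _ (Tendsto.pow ?_ 2)
    have hdiv : Tendsto (fun N : ℕ => (N : ℝ) / n) atTop atTop :=
      tendsto_natCast_atTop_atTop.atTop_div_const (by exact_mod_cast hpos)
    exact (tendsto_nat_floor_div_atTop (R := ℝ)).comp hdiv
  rw [one_pow, mul_one] at hlim
  filter_upwards [hlim.eventually_const_lt hn, eventually_ge_atTop n] with N h1 h2
  exact h1.trans_le (normalizedThreshold_mul_le hpos h2)

theorem coveringRatio_eq {n : ℕ} (hn : 3 ≤ n) : coveringRatio 3 1 (tightCycle 3 5) n =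
    normalizedThreshold n / ((1 - 1 / (n : ℝ)) * (1 - 2 / (n : ℝ))) := by
  have h3 : (3 : ℝ) ≤ n := by exact_mod_cast hn
  have h1 : (n : ℝ) - 1 ≠ 0 := by linarith
  have h2 : (n : ℝ) - 2 ≠ 0 := by linarith
  have h0 : (n : ℝ) ≠ 0 := by linarith
  rw [coveringRatio, normalizedThreshold, Nat.cast_choose_two, Nat.cast_sub (by omega)]
  have e : (n : ℝ) - (1 : ℕ) - 1 = n - 2 := by push_cast; ring
  rw [e, Nat.cast_one, one_sub_div h0, one_sub_div h0]
  field_simp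

theorem tendsto_coveringRatio : Tendsto (coveringRatio 3 1 (tightCycle 3 5)) atTop
    (𝓝 (⨆ n, normalizedThreshold n)) := by
  have h1 : Tendsto (fun n : ℕ => (1 - 1 / (n : ℝ)) * (1 - 2 / (n : ℝ))) atTop
      (𝓝 ((1 - 0) * (1 - 0))) :=
    (tendsto_const_nhds.sub (tendsto_const_div_atTop_nhds_zero_nat 1)).mul
      (tendsto_const_nhds.sub (tendsto_const_div_atTop_nhds_zero_nat 2))
  have h2 := tendsto_normalizedThreshold.div h1 (by norm_num)
  rw [sub_zero, one_mul, div_one] at h2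
  refine h2.congr' ?_
  filter_upwards [eventually_ge_atTop 3] with n hn
  exact (coveringRatio_eq hn).symm

theorem coveringDensity_eq :
    coveringDensity 3 1 (tightCycle 3 5) = ⨆ n, normalizedThreshold n :=
  tendsto_coveringRatio.limUnder_eq

theorem five_ninths_le_iSup : (5 / 9 : ℝ) ≤ ⨆ n, normalizedThreshold n := by
  have h : Tendsto (fun m : ℕ => (5 - 3 / (m : ℝ)) / (3 + 1 / (m : ℝ)) ^ 2) atTop
      (𝓝 ((5 - 0) / (3 + 0) ^ 2)) :=
    (tendsto_const_nhds.sub (tendsto_const_div_atTop_nhds_zero_nat 3)).div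
      ((tendsto_const_nhds.add (tendsto_const_div_atTop_nhds_zero_nat 1)).pow 2) (by norm_num)
  have e : ((5 - 0) / (3 + 0) ^ 2 : ℝ) = 5 / 9 := by norm_num
  rw [e] at h
  refine le_of_tendsto h ?_
  filter_upwards [eventually_gt_atTop 0] with m hm
  refine le_trans ?_ (le_ciSup bddAbove_normalizedThreshold (3 * m + 1))
  have hm' : (0 : ℝ) < m := by exact_mod_cast hm
  have h1 : 5 * (m : ℝ) ^ 2 - 3 * m ≤
      2 * coveringThreshold 3 1 (3 * m + 1) (tightCycle 3 5) := by
    rw [sub_le_iff_le_add]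
    have := le_coveringThreshold_three_mul_add_one m
    exact_mod_cast (show 5 * m ^ 2 ≤
      2 * coveringThreshold 3 1 (3 * m + 1) (tightCycle 3 5) + 3 * m by omega)
  have e : (5 - 3 / (m : ℝ)) / (3 + 1 / (m : ℝ)) ^ 2 =
      (5 * (m : ℝ) ^ 2 - 3 * m) / ((3 * m + 1 : ℕ) : ℝ) ^ 2 := by
    push_cast
    field_simp
  rw [e, normalizedThreshold]
  gcongr

theorem iSup_le_two_sub_sqrt_two : ⨆ n, normalizedThreshold n ≤ 2 - Real.sqrt 2 := by
  have hlim := tendsto_normalizedThreshold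
  have h1 : ⨆ n, normalizedThreshold n ≤ 1 := ciSup_le normalizedThreshold_le_one
  set c := ⨆ n, normalizedThreshold n
  have h2 : 2 * c ≤ 1 + (1 - c) ^ 2 + 0 := by
    refine le_of_tendsto_of_tendsto (hlim.const_mul 2)
      ((((hlim.const_sub 1).pow 2).const_add 1).add (tendsto_const_div_atTop_nhds_zero_nat 4)) ?_
    filter_upwards [eventually_gt_atTop 0] with n hn
    have : NeZero n := ⟨hn.ne'⟩
    exact coveringThreshold_sq_le rfl
  -- The inequality `h2` says `(2 - c)² ≥ 2`; `c ≤ 1` excludes the branch `c ≥ 2 + √2`.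
  have h3 : Real.sqrt 2 ≤ 2 - c := Real.sqrt_le_iff.2 ⟨by linarith, by nlinarith⟩
  linarith

end Hypergraph

theorem mainTheorem7 :
    Tendsto (Hypergraph.coveringRatio 3 1 (Hypergraph.tightCycle 3 5)) atTop
      (𝓝 (Hypergraph.coveringDensity 3 1 (Hypergraph.tightCycle 3 5))) ∧
    (5 / 9 : ℝ) ≤ Hypergraph.coveringDensity 3 1 (Hypergraph.tightCycle 3 5) ∧
    Hypergraph.coveringDensity 3 1 (Hypergraph.tightCycle 3 5) ≤ 2 - Real.sqrt 2 := by
  rw [Hypergraph.coveringDensity_eq]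
  exact ⟨Hypergraph.tendsto_coveringRatio, Hypergraph.five_ninths_le_iSup,
    Hypergraph.iSup_le_two_sub_sqrt_two⟩
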